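/- \textbf{Lower bound for sparse PCA.} For integers $p,n\ge 1$ and reals $\lambda_1>\lambda_2\ge 0$ put $\sigma^2=\lambda_1\lambda_2/(\lambda_1-\lambda_2)^2$. For $q\in(0,1]$ let $\mathbb{B}_q^p(R)=\{\theta\in\mathbb{R}^p:\sum_{j}|\theta_j|^q\le R\}$, and let $\mathbb{B}_0^p(R)$ be the set of $\theta\in\mathbb{R}^p$ with at most $R$ nonzero entries. Let $\mathcal{M}_q=\mathcal{M}_q(p,\lambda_1,\lambda_2,\bar R_q)$ be the class of all probability distributions $P$ on $\mathbb{R}^p$ with finite second moments whose covariance matrix has the form $\Sigma=\lambda_1\theta_1\theta_1^T+\lambda_2\Sigma_0$, where $\|\theta_1\|_2=1$, $\theta_1\in\mathbb{B}_q^p(\bar R_q+1)$, $\Sigma_0$ is positive semidefinite, $\Sigma_0\theta_1=0$ and $\Sigma_0$ has spectral norm $1$. (Then $\theta_1$ is determined by $P$ up to sign.) Let $q\in[0,1]$, $\alpha\in(0,1]$ and $\kappa>0$. There is a constant $c>0$ depending only on $q$, $\alpha$, $\kappa$ (so only on $q$, if $\alpha$ and $\kappa$ are chosen as functions of $q$)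 such that for all $p,n\ge1$, all $\lambda_1>\lambda_2\ge0$ and all real $\bar R_q$ with $$\bar R_q\le\kappa^q(p-1)^{1-\alpha}\,\bar R_q^{\frac{2\alpha}{2-q}}\left[\frac{\sigma^2}{n}\log\frac{p-1}{\bar R_q^{2/(2-q)}}\right]^{q/2}\quad\text{and}\quad 1\le\bar R_q\le e^{-1}(p-1)^{1-q/2},$$ every measurable estimator $\hat\theta_1=\hat\theta_1(X_1,\dots,X_n)\in\mathbb{R}^p$, based on independent observations $X_1,\dots,X_n$ with common distribution $P$, satisfies $$\sup_{P\in\mathcal{M}_q}\mathbb{E}_P\big\|\hat\theta_1\hat\theta_1^T-\theta_1\theta_1^T\big\|_F\;\ge\;c\,\min\left\{1,\;\bar R_q^{1/2}\left[\frac{\sigma^2}{n}\log\frac{p-1}{\bar R_q^{2/(2-q)}}\right]^{\frac12-\frac q4}\right\}.$$ The same lower bound, with the same $c$, holds when the supremum is restricted to the Gaussian distributions in $\mathcal{M}_q$. -/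

import Mathlib

open MeasureTheory ProbabilityTheory
open scoped ENNReal

namespace SparsePCA

/-- The squared noise-to-signal ratio `σ² = λ₁ λ₂ / (λ₁ - λ₂)²`. -/
noncomputable def sigmaSq (l₁ l₂ : ℝ) : ℝ := l₁ * l₂ / (l₁ - l₂) ^ 2

/-- The `ℓ_q` ball of radius `R` in `ℝ^p`; for `q = 0` the number of nonzero entries is at most
`R`, for `q ≠ 0` the sum of the `|θ_j|^q` is at most `R`. -/
noncomputable def lqBall (q : ℝ) (p : ℕ) (R : ℝ) : Set (EuclideanSpace ℝ (Fin p)) :=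
  {θ | if q = 0 then ({j | θ j ≠ 0}.ncard : ℝ) ≤ R else ∑ j, |θ j| ^ q ≤ R}

/-- The rank one matrix `θ θᵀ`. -/
def outer {p : ℕ} (θ : EuclideanSpace ℝ (Fin p)) : Matrix (Fin p) (Fin p) ℝ :=
  Matrix.of fun i j => θ i * θ j

/-- The Frobenius norm of a real matrix. -/
noncomputable def frobNorm {p : ℕ} (A : Matrix (Fin p) (Fin p) ℝ) : ℝ :=
  Real.sqrt (∑ i, ∑ j, A i j ^ 2)

/-- The covariance matrix `E X Xᵀ - (E X)(E X)ᵀ` of a random vector `X` with law `P`. -/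
noncomputable def covMatrix {p : ℕ} (P : Measure (EuclideanSpace ℝ (Fin p))) :
    Matrix (Fin p) (Fin p) ℝ :=
  Matrix.of fun i j => cov[fun x => x i, fun x => x j; P]

/-- `P` is a probability distribution on `ℝ^p` with finite second moments whose covariance matrix
is `λ₁ θ θᵀ + λ₂ Σ₀`, where `θ` is a unit vector, `Σ₀` is positive semidefinite, `Σ₀ θ = 0` and
the spectral norm of `Σ₀` is one. -/
structure IsModel {p : ℕ} (l₁ l₂ : ℝ) (θ : EuclideanSpace ℝ (Fin p))
    (P : Measure (EuclideanSpace ℝ (Fin p))) : Prop where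
  isProbabilityMeasure : IsProbabilityMeasure P
  memLp : MemLp (fun x : EuclideanSpace ℝ (Fin p) => x) 2 P
  norm_eq_one : ‖θ‖ = 1
  covMatrix_eq : ∃ S₀ : Matrix (Fin p) (Fin p) ℝ,
    S₀.PosSemidef ∧ Matrix.toEuclideanCLM (𝕜 := ℝ) S₀ θ = 0 ∧
      ‖Matrix.toEuclideanCLM (𝕜 := ℝ) S₀‖ = 1 ∧
      covMatrix P = l₁ • outer θ + l₂ • S₀

/-- The model class: pairs of a distribution `P` of a single observation and its leading
eigenvector `θ` (unique up to sign, so that `θ θᵀ` is a function of `P` when `0 ≤ λ₂ < λ₁`),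
with `θ` in the `ℓ_q` ball of radius `Rbar + 1`. -/
def modelClass (q : ℝ) (p : ℕ) (l₁ l₂ Rbar : ℝ) :
    Set (Measure (EuclideanSpace ℝ (Fin p)) × EuclideanSpace ℝ (Fin p)) :=
  {Pθ | IsModel l₁ l₂ Pθ.2 Pθ.1 ∧ Pθ.2 ∈ lqBall q p (Rbar + 1)}

/-- The members of the model class whose observations are Gaussian. -/
def gaussianModelClass (q : ℝ) (p : ℕ) (l₁ l₂ Rbar : ℝ) :
    Set (Measure (EuclideanSpace ℝ (Fin p)) × EuclideanSpace ℝ (Fin p)) :=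
  {Pθ | Pθ ∈ modelClass q p l₁ l₂ Rbar ∧ IsGaussian Pθ.1}

/-- The condition on the radius `Rbar`. -/
structure RadiusCondition (q α κ : ℝ) (p n : ℕ) (l₁ l₂ Rbar : ℝ) : Prop where
  upper : Rbar ≤ κ ^ q * ((p : ℝ) - 1) ^ (1 - α) * Rbar ^ (2 * α / (2 - q)) *
    (sigmaSq l₁ l₂ / n * Real.log (((p : ℝ) - 1) / Rbar ^ (2 / (2 - q)))) ^ (q / 2)
  one_le : 1 ≤ Rbar
  le_dim : Rbar ≤ (Real.exp 1)⁻¹ * ((p : ℝ) - 1) ^ (1 - q / 2)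

/-- The expected loss `E ‖θ̂ θ̂ᵀ - θ θᵀ‖_F` of the estimator `est` based on `n` independent
observations with distribution `P` (a value in `[0, ∞]`). -/
noncomputable def risk {p n : ℕ}
    (est : (Fin n → EuclideanSpace ℝ (Fin p)) → EuclideanSpace ℝ (Fin p))
    (P : Measure (EuclideanSpace ℝ (Fin p))) (θ : EuclideanSpace ℝ (Fin p)) : ℝ≥0∞ :=
  ∫⁻ x, ENNReal.ofReal (frobNorm (outer (est x) - outer θ)) ∂(Measure.pi fun _ : Fin n => P)

/-- The worst-case expected loss of the estimator `est` over a class `S` of pairs `(P, θ)`. -/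
noncomputable def worstCaseRisk {p n : ℕ}
    (S : Set (Measure (EuclideanSpace ℝ (Fin p)) × EuclideanSpace ℝ (Fin p)))
    (est : (Fin n → EuclideanSpace ℝ (Fin p)) → EuclideanSpace ℝ (Fin p)) : ℝ≥0∞ :=
  ⨆ Pθ ∈ S, risk est Pθ.1 Pθ.2

/-- The lower bound on the worst-case expected loss, without its constant. -/
noncomputable def rate (q : ℝ) (p n : ℕ) (l₁ l₂ Rbar : ℝ) : ℝ :=
  min 1 (Rbar ^ (1 / 2 : ℝ) *
    (sigmaSq l₁ l₂ / n * Real.log (((p : ℝ) - 1) / Rbar ^ (2 / (2 - q)))) ^ (1 / 2 - q / 4))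

end SparsePCA

/-! The bound is proved on a finite family of spiked Gaussians with covariance `λ₁ θ θᵀ + λ₂ (I - θ
θᵀ)`. The spikes are indexed by words `w` of length `s` over an alphabet of size `m`: `θ` has one
entry `√(1 - ε²)` and, in each of `s` disjoint blocks of `m` coordinates, one entry `ε / √s` at the
position named by the letter. Two spikes have inner product `1 - ε² h / s`, where `h` is the Hamming
distance of the words.

Changing one letter costs a divergence of at most `n ε² / (s σ²)`. If this is at most `log m / 12`,
a Fano bound applied letter by letter (`sum_measureReal_test_le`, `sum_measureReal_letter_le`) makes
every letter wrong with average probability at least `1/4`. The Frobenius distance of two spikes is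
at least `ε h / s`, so decoding an estimator to the nearest word turns wrong letters into loss, and
the risk is at least `ε / 8` (`exists_le_risk`). This combines Assouad's additivity over blocks with
Fano's `log m` and needs no packing set.

It remains to choose a sparsity `S ≈ s`, with `m ≈ (p - 1) / S`, subject to `ε ^ q S ^ (1 - q/2) ≤
R`. Let `L = log ((p - 1) / R ^ (2/(2-q)))` and `t = σ² L / n`. The choice `S = R ^ (2/(2-q))`
(`le_worstCaseRisk_of_radius`) settles `q = 0` and the cases where the bound is a constant.
Otherwise `S` is proportional to `R t ^ (-q/2)` (`le_worstCaseRisk_of_effective_sparsity`); there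
the upper condition on the radius ensures `log ((p - 1) / S) ≥ α L`, so the logarithm loses only a
constant factor. -/

namespace SparsePCA

open scoped RealInnerProductSpace

/-! ### Densities of product and standard Gaussian measures -/

/-- A product of measures with integrable densities has the product density. -/
theorem pi_withDensity_ofReal {ι : Type*} [Fintype ι] {X : Type*} [MeasurableSpace X]
    (μ : Measure X) [SigmaFinite μ] (f : X → ℝ) (hf0 : ∀ x, 0 ≤ f x)
    (hfi : Integrable f μ) :
    Measure.pi (fun _ : ι => μ.withDensity fun x => ENNReal.ofReal (f x)) =
      (Measure.pi fun _ : ι => μ).withDensity fun x => ENNReal.ofReal (∏ i, f (x i)) := by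
  have : IsFiniteMeasure (μ.withDensity fun x => ENNReal.ofReal (f x)) :=
    isFiniteMeasure_withDensity_ofReal hfi.2
  refine Measure.pi_eq fun s hs => ?_
  rw [withDensity_apply _ (MeasurableSet.univ_pi hs), Measure.restrict_pi_pi,
    ← ofReal_integral_eq_lintegral_ofReal, integral_fintype_prod_eq_prod,
    ENNReal.ofReal_prod_of_nonneg]
  · refine Finset.prod_congr rfl fun i _ => ?_
    rw [withDensity_apply _ (hs i), ← ofReal_integral_eq_lintegral_ofReal hfi.restrict
      (Filter.Eventually.of_forall hf0)]
  · exact fun i _ => integral_nonneg hf0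
  · exact Integrable.fintype_prod fun i => hfi.restrict
  · exact Filter.Eventually.of_forall fun x => Finset.prod_nonneg fun i _ => hf0 _

theorem stdGaussian_eq_withDensity {p : ℕ} :
    stdGaussian (EuclideanSpace ℝ (Fin p)) =
      volume.withDensity fun x => ENNReal.ofReal ((√(2 * Real.pi))⁻¹ ^ p * Real.exp (-‖x‖ ^ 2 / 2)) := by
  have h1 : gaussianReal 0 1 = volume.withDensity fun x => ENNReal.ofReal (gaussianPDFReal 0 1 x) := by
    rw [gaussianReal_of_var_ne_zero _ one_ne_zero]; rfl
  rw [← map_pi_eq_stdGaussian, h1, pi_withDensity_ofReal _ _ (gaussianPDFReal_nonneg 0 1)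
    (integrable_gaussianPDFReal 0 1)]
  ext s hs
  rw [Measure.map_apply (by fun_prop) hs, withDensity_apply _ hs,
    withDensity_apply _ ((by fun_prop : Measurable (WithLp.toLp 2 : (Fin p → ℝ) → _)) hs),
    ← (PiLp.volume_preserving_toLp (Fin p)).setLIntegral_comp_preimage hs (by fun_prop)]
  refine setLIntegral_congr_fun ((by fun_prop : Measurable (WithLp.toLp 2 : (Fin p → ℝ) → _)) hs)
    fun x _ => ?_
  simp only [gaussianPDFReal]
  rw [Finset.prod_mul_distrib, ← Real.exp_sum, EuclideanSpace.real_norm_sq_eq]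
  simp [Finset.sum_div, Finset.sum_neg_distrib, neg_div]

/-! ### Operators with one distinguished eigenvector -/

section Spike

variable {E : Type*} [NormedAddCommGroup E] [InnerProductSpace ℝ E]

/-- The operator with eigenvalue `b` at the unit vector `θ` and `a` on its complement. -/
noncomputable def spikeMap (a b : ℝ) (θ : E) : E →L[ℝ] E :=
  a • ContinuousLinearMap.id ℝ E + (b - a) • (innerSL ℝ θ).smulRight θ

theorem spikeMap_apply (a b : ℝ) (θ x : E) :
    spikeMap a b θ x = a • x + ((b - a) * ⟪θ, x⟫) • θ := by
  simp [spikeMap, smul_smul]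

theorem inner_spikeMap (a b : ℝ) (θ x y : E) :
    ⟪spikeMap a b θ x, y⟫ = a * ⟪x, y⟫ + (b - a) * ⟪θ, x⟫ * ⟪θ, y⟫ := by
  rw [spikeMap_apply, inner_add_left, real_inner_smul_left, real_inner_smul_left]

theorem inner_spikeMap_right (a b : ℝ) (θ x y : E) :
    ⟪x, spikeMap a b θ y⟫ = a * ⟪x, y⟫ + (b - a) * ⟪θ, x⟫ * ⟪θ, y⟫ := by
  rw [spikeMap_apply, inner_add_right, real_inner_smul_right, real_inner_smul_right,
    real_inner_comm x θ]
  ring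

theorem spikeMap_spikeMap (a b a' b' : ℝ) {θ : E} (hθ : ‖θ‖ = 1) (x : E) :
    spikeMap a b θ (spikeMap a' b' θ x) = spikeMap (a * a') (b * b') θ x := by
  simp only [spikeMap_apply, inner_add_right, real_inner_smul_right, real_inner_self_eq_norm_sq, hθ,
    smul_add, smul_smul, add_assoc, ← add_smul]
  congr 2
  ring

theorem spikeMap_one_one (θ x : E) : spikeMap 1 1 θ x = x := by
  simp [spikeMap_apply]

theorem norm_spikeMap_sq (a b : ℝ) {θ : E} (hθ : ‖θ‖ = 1) (x : E) :
    ‖spikeMap a b θ x‖ ^ 2 = a ^ 2 * ‖x‖ ^ 2 + (b ^ 2 - a ^ 2) * ⟪θ, x⟫ ^ 2 := by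
  rw [← real_inner_self_eq_norm_sq, inner_spikeMap, real_inner_comm, inner_spikeMap_right,
    inner_spikeMap, real_inner_self_eq_norm_sq, real_inner_self_eq_norm_sq, hθ]
  ring

/-- The reflection exchanging `θ` and `θ'` conjugates one operator into the other. Hence Gaussian
normalising constants agree for all unit spikes and the determinant never has to be computed. -/
theorem det_spikeMap [FiniteDimensional ℝ E] (a b : ℝ) {θ θ' : E} (h : ‖θ‖ = ‖θ'‖) :
    LinearMap.det (spikeMap a b θ : E →ₗ[ℝ] E) = LinearMap.det (spikeMap a b θ' : E →ₗ[ℝ] E) := by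
  set U : E ≃ₗᵢ[ℝ] E := (ℝ ∙ (θ - θ'))ᗮ.reflection with hU
  have hUθ : U θ = θ' := Submodule.reflection_sub h
  rw [← LinearMap.det_conj (spikeMap a b θ : E →ₗ[ℝ] E) U.toLinearEquiv]
  congr 1
  ext x
  have h2 : ⟪θ', x⟫ = ⟪θ, U.symm x⟫ := by
    rw [← hUθ, ← U.inner_map_map θ (U.symm x), U.apply_symm_apply]
  have : U (spikeMap a b θ (U.symm x)) = spikeMap a b θ' x := by
    simp only [spikeMap_apply, map_add, map_smul, hUθ, U.apply_symm_apply, h2]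
  simpa using this

end Spike

/-! ### Spiked Gaussian distributions: moments and densities -/

variable {p n : ℕ}

/-- The centred Gaussian distribution with covariance `l₁ θ θᵀ + l₂ (I - θ θᵀ)`. -/
noncomputable def spiked (l₁ l₂ : ℝ) (θ : EuclideanSpace ℝ (Fin p)) :
    Measure (EuclideanSpace ℝ (Fin p)) :=
  (stdGaussian (EuclideanSpace ℝ (Fin p))).map (spikeMap √l₂ √l₁ θ)

instance (l₁ l₂ : ℝ) (θ : EuclideanSpace ℝ (Fin p)) : IsGaussian (spiked l₁ l₂ θ) := by
  unfold spiked; infer_instance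

theorem memLp_spiked (l₁ l₂ : ℝ) (θ : EuclideanSpace ℝ (Fin p)) :
    MemLp id 2 (spiked l₁ l₂ θ) := IsGaussian.memLp_two_id

theorem covarianceBilin_spiked {l₁ l₂ : ℝ} (h₁ : 0 ≤ l₁) (h₂ : 0 ≤ l₂)
    {θ : EuclideanSpace ℝ (Fin p)} (hθ : ‖θ‖ = 1) (x y : EuclideanSpace ℝ (Fin p)) :
    covarianceBilin (spiked l₁ l₂ θ) x y = l₂ * ⟪x, y⟫ + (l₁ - l₂) * ⟪θ, x⟫ * ⟪θ, y⟫ := by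
  have hadj : (spikeMap √l₂ √l₁ θ).adjoint = spikeMap √l₂ √l₁ θ := by
    refine ((ContinuousLinearMap.eq_adjoint_iff _ _).2 fun x y => ?_).symm
    rw [inner_spikeMap, inner_spikeMap_right]
  rw [spiked, covarianceBilin_map IsGaussian.memLp_two_id, covarianceBilin_stdGaussian, hadj,
    innerSL_apply_apply ℝ, inner_spikeMap, inner_spikeMap_right, inner_spikeMap_right,
    real_inner_self_eq_norm_sq, hθ]
  have e₁ := Real.mul_self_sqrt h₁
  have e₂ := Real.mul_self_sqrt h₂
  linear_combination (⟪θ, x⟫ * ⟪θ, y⟫) * e₁ + (⟪x, y⟫ - ⟪θ, x⟫ * ⟪θ, y⟫) * e₂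

theorem integral_inner_spiked (l₁ l₂ : ℝ) (θ u : EuclideanSpace ℝ (Fin p)) :
    ∫ x, ⟪u, x⟫ ∂(spiked l₁ l₂ θ) = 0 := by
  rw [spiked, integral_map (by fun_prop) (by fun_prop)]
  have := integral_strongDual_stdGaussian (E := EuclideanSpace ℝ (Fin p))
    ((innerSL ℝ u).comp (spikeMap √l₂ √l₁ θ))
  simpa using this

theorem memLp_inner_spiked (l₁ l₂ : ℝ) (θ u : EuclideanSpace ℝ (Fin p)) :
    MemLp (fun x => ⟪u, x⟫) 2 (spiked l₁ l₂ θ) :=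
  (innerSL ℝ u).comp_memLp' (memLp_spiked l₁ l₂ θ)

theorem integral_inner_sq_spiked {l₁ l₂ : ℝ} (h₁ : 0 ≤ l₁) (h₂ : 0 ≤ l₂)
    {θ : EuclideanSpace ℝ (Fin p)} (hθ : ‖θ‖ = 1) (u : EuclideanSpace ℝ (Fin p)) :
    ∫ x, ⟪u, x⟫ ^ 2 ∂(spiked l₁ l₂ θ) = l₂ * ‖u‖ ^ 2 + (l₁ - l₂) * ⟪θ, u⟫ ^ 2 := by
  have h := covarianceBilin_self (memLp_spiked l₁ l₂ θ) u
  rw [covarianceBilin_spiked h₁ h₂ hθ, variance_eq_integral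
    (memLp_inner_spiked l₁ l₂ θ u).aemeasurable, integral_inner_spiked,
    real_inner_self_eq_norm_sq] at h
  simp only [sub_zero] at h
  rw [← h]; ring

/-- Spiked Gaussian distributions have an explicit Lebesgue density. -/
theorem spiked_eq_withDensity {l₁ l₂ : ℝ} (h₁ : 0 < l₁) (h₂ : 0 < l₂)
    {θ : EuclideanSpace ℝ (Fin p)} (hθ : ‖θ‖ = 1) :
    spiked l₁ l₂ θ = volume.withDensity fun x => ENNReal.ofReal
      (|(LinearMap.det (spikeMap √l₂ √l₁ θ : EuclideanSpace ℝ (Fin p) →ₗ[ℝ] _))⁻¹| *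
        ((√(2 * Real.pi))⁻¹ ^ p *
          Real.exp (-(l₂⁻¹ * ‖x‖ ^ 2 + (l₁⁻¹ - l₂⁻¹) * ⟪θ, x⟫ ^ 2) / 2))) := by
  have hs₁ := (Real.sqrt_pos.2 h₁).ne'
  have hs₂ := (Real.sqrt_pos.2 h₂).ne'
  set A := spikeMap √l₂ √l₁ θ
  set B := spikeMap (√l₂)⁻¹ (√l₁)⁻¹ θ
  have hAB : ∀ x, A (B x) = x := fun x => by
    rw [spikeMap_spikeMap _ _ _ _ hθ, mul_inv_cancel₀ hs₁, mul_inv_cancel₀ hs₂, spikeMap_one_one]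
  have hBA : ∀ x, B (A x) = x := fun x => by
    rw [spikeMap_spikeMap _ _ _ _ hθ, inv_mul_cancel₀ hs₁, inv_mul_cancel₀ hs₂, spikeMap_one_one]
  have hdet : LinearMap.det (A : EuclideanSpace ℝ (Fin p) →ₗ[ℝ] _) ≠ 0 := by
    have : (A : EuclideanSpace ℝ (Fin p) →ₗ[ℝ] _) ∘ₗ (B : EuclideanSpace ℝ (Fin p) →ₗ[ℝ] _)
        = LinearMap.id := by ext1 x; exact hAB x
    have h := congrArg LinearMap.det this
    rw [LinearMap.det_comp, LinearMap.det_id] at h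
    exact left_ne_zero_of_mul_eq_one h
  have hvol : volume.map A = ENNReal.ofReal
      |(LinearMap.det (A : EuclideanSpace ℝ (Fin p) →ₗ[ℝ] _))⁻¹| •
      (volume : Measure (EuclideanSpace ℝ (Fin p))) :=
    Measure.map_linearMap_addHaar_eq_smul_addHaar _ hdet
  rw [spiked, stdGaussian_eq_withDensity]
  ext s hs
  have hsA : MeasurableSet (A ⁻¹' s) := A.continuous.measurable hs
  rw [Measure.map_apply A.continuous.measurable hs, withDensity_apply _ hs, withDensity_apply _ hsA]
  have key : ∫⁻ x in A ⁻¹' s, ENNReal.ofReal ((√(2 * Real.pi))⁻¹ ^ p * Real.exp (-‖x‖ ^ 2 / 2)) =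
      ∫⁻ y in s, ENNReal.ofReal ((√(2 * Real.pi))⁻¹ ^ p * Real.exp (-‖B y‖ ^ 2 / 2))
        ∂(volume.map A) := by
    rw [setLIntegral_map hs (by fun_prop) A.continuous.measurable]
    simp only [hBA]
  rw [key, hvol, Measure.restrict_smul, lintegral_smul_measure, smul_eq_mul,
    ← lintegral_const_mul _ (by fun_prop)]
  refine lintegral_congr fun y => ?_
  rw [← ENNReal.ofReal_mul (abs_nonneg _), norm_spikeMap_sq _ _ hθ, inv_pow (√l₁), inv_pow (√l₂),
    Real.sq_sqrt h₁.le, Real.sq_sqrt h₂.le]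

/-- The determinants and the `‖x‖²` terms cancel in the quotient of the two densities, leaving only
the squared projections on the spikes. -/
theorem spiked_eq_withDensity_spiked {l₁ l₂ : ℝ} (h₁ : 0 < l₁) (h₂ : 0 < l₂)
    {θ θ' : EuclideanSpace ℝ (Fin p)} (hθ : ‖θ‖ = 1) (hθ' : ‖θ'‖ = 1) :
    spiked l₁ l₂ θ' = (spiked l₁ l₂ θ).withDensity fun x => ENNReal.ofReal
      (Real.exp (-((l₂⁻¹ - l₁⁻¹) / 2 * (⟪θ, x⟫ ^ 2 - ⟪θ', x⟫ ^ 2)))) := by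
  rw [spiked_eq_withDensity h₁ h₂ hθ, spiked_eq_withDensity h₁ h₂ hθ',
    ← withDensity_mul _ (by fun_prop) (by fun_prop), det_spikeMap _ _ (hθ'.trans hθ.symm)]
  congr 1
  ext x
  rw [Pi.mul_apply, ← ENNReal.ofReal_mul (by positivity), mul_assoc, mul_assoc, ← Real.exp_add]
  ring_nf

/-! ### A Fano-type inequality for tests -/

/-- The Gibbs variational inequality for `log m` times the indicator of an event, in a linearised
form with the free parameter `b`. -/
theorem log_mul_measureReal_le {Ω : Type*} [MeasurableSpace Ω] {P Q : Measure Ω}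
    [IsProbabilityMeasure P] [IsProbabilityMeasure Q] {l : Ω → ℝ} (hl : Measurable l)
    (hli : Integrable l P) (hQ : Q = P.withDensity fun x => ENNReal.ofReal (Real.exp (-l x)))
    {A : Set Ω} (hA : MeasurableSet A) {m : ℝ} (hm : 0 < m) (b : ℝ) :
    Real.log m * P.real A - ∫ x, l x ∂P - b ≤ Real.exp (-b) * (1 + (m - 1) * Q.real A) - 1 := by
  have hint : Integrable (fun x => Real.exp (-l x)) P := by
    refine ⟨by fun_prop, ?_⟩
    rw [hasFiniteIntegral_iff_ofReal (Filter.Eventually.of_forall fun x => (Real.exp_pos _).le),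
      ← setLIntegral_univ, ← withDensity_apply _ MeasurableSet.univ, ← hQ]
    exact measure_lt_top _ _
  have hmass : ∀ B, MeasurableSet B → ∫ x in B, Real.exp (-l x) ∂P = Q.real B := by
    intro B hB
    rw [integral_eq_lintegral_of_nonneg_ae (Filter.Eventually.of_forall fun x => (Real.exp_pos _).le)
      (by fun_prop), ← withDensity_apply _ hB, ← hQ, measureReal_def]
  have hone : ∫ x, Real.exp (-l x) ∂P = 1 := by
    rw [← setIntegral_univ, hmass _ MeasurableSet.univ, probReal_univ]
  have hind : Integrable (A.indicator fun _ => Real.log m) P := (integrable_const _).indicator hA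
  have hindl : Integrable (fun x => A.indicator (fun _ => Real.log m) x - l x) P := hind.sub hli
  have hindexp : Integrable (fun x => (m - 1) * A.indicator (fun x => Real.exp (-l x)) x) P :=
    (hint.indicator hA).const_mul _
  have hsum : Integrable (fun x => Real.exp (-b) *
      (Real.exp (-l x) + (m - 1) * A.indicator (fun x => Real.exp (-l x)) x)) P :=
    (hint.add hindexp).const_mul _
  have hexp : Integrable (fun x => Real.exp (-b) *
      (Real.exp (-l x) + (m - 1) * A.indicator (fun x => Real.exp (-l x)) x) - 1) P :=
    hsum.sub (integrable_const _)
  have hlin : Integrable (fun x => A.indicator (fun _ => Real.log m) x - l x - b) P :=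
    hindl.sub (integrable_const _)
  -- The inequality `u + 1 ≤ exp u` at `u = log m · 1_A - l - b` is integrated under `P`; the factor
  -- `exp (-l)` changes `P` into `Q`.
  have h := integral_mono hlin hexp fun x => by
    have h1 := Real.add_one_le_exp (A.indicator (fun _ => Real.log m) x - l x - b)
    have h2 : Real.exp (A.indicator (fun _ => Real.log m) x - l x - b) = Real.exp (-b) *
        (Real.exp (-l x) + (m - 1) * A.indicator (fun x => Real.exp (-l x)) x) := by
      by_cases hx : x ∈ A
      · simp only [Set.indicator_of_mem hx]
        rw [sub_sub, sub_eq_add_neg, Real.exp_add, Real.exp_log hm, neg_add, Real.exp_add]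
        ring
      · simp only [Set.indicator_of_notMem hx]
        rw [zero_sub, sub_eq_add_neg, Real.exp_add]
        ring
    change _ ≤ _ - 1
    rw [← h2]
    linarith
  rw [integral_sub hindl (integrable_const _), integral_sub hind hli,
    integral_indicator_const _ hA, integral_sub hsum (integrable_const _),
    integral_const_mul, integral_add hint hindexp, integral_const_mul,
    integral_indicator hA, hmass A hA, hone] at h
  simp only [integral_const, probReal_univ, smul_eq_mul, one_mul] at h
  linarith

/-- The left side is the price paid for random guessing in the Fano bound; the factor `2/3` leaves
room for a divergence of `log m / 12`, as `2/3 + 1/12 = 3/4`. -/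
theorem log_two_sub_inv_le {m : ℝ} (hm : m = 2 ∨ 3 ≤ m) :
    Real.log (2 - m⁻¹) ≤ 2 / 3 * Real.log m := by
  have h : Real.log ((2 - m⁻¹) ^ 3) ≤ Real.log (m ^ 2) := by
    -- For `m = 2` the cubes and squares give `27/8 ≤ 4`; for `m ≥ 3` they give `(2 - m⁻¹)³ ≤ 8 ≤ 9
    -- ≤ m²`.
    rcases hm with rfl | hm
    · exact Real.log_le_log (by norm_num) (by norm_num)
    · have h1 : 0 < m⁻¹ := by positivity
      have h2 : m⁻¹ ≤ 1 := inv_le_one_of_one_le₀ (by linarith)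
      have h3 : (2 - m⁻¹) ^ 3 ≤ 2 ^ 3 := pow_le_pow_left₀ (by linarith) (by linarith) 3
      exact Real.log_le_log (pow_pos (by linarith) 3) (by nlinarith)
  rw [Real.log_pow, Real.log_pow] at h
  push_cast at h
  linarith

/-- Fano-type bound: a test among `m` hypotheses whose divergence to a common reference is at most
`log m / 12` is wrong with average probability at least a quarter. -/
theorem sum_measureReal_test_le {Ω J : Type*} [MeasurableSpace Ω] [Fintype J] [MeasurableSpace J]
    [MeasurableSingletonClass J] (P : J → Measure Ω) (Q : Measure Ω)
    [∀ j, IsProbabilityMeasure (P j)] [IsProbabilityMeasure Q] (l : J → Ω → ℝ)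
    (hl : ∀ j, Measurable (l j)) (hli : ∀ j, Integrable (l j) (P j))
    (hQ : ∀ j, Q = (P j).withDensity fun x => ENNReal.ofReal (Real.exp (-l j x)))
    (hJ : 2 ≤ Fintype.card J)
    (hkl : ∀ j, ∫ x, l j x ∂(P j) ≤ Real.log (Fintype.card J) / 12)
    {T : Ω → J} (hT : Measurable T) :
    ∑ j, (P j).real (T ⁻¹' {j}) ≤ 3 / 4 * Fintype.card J := by
  set m : ℝ := (Fintype.card J : ℝ) with hmdef
  have hm2 : (2 : ℝ) ≤ m := by rw [hmdef]; exact_mod_cast hJ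
  have hm0 : 0 < m := by linarith
  have hm23 : m = 2 ∨ 3 ≤ m := by
    rcases hJ.eq_or_lt with h | h
    · left; rw [hmdef, ← h]; norm_num
    · right; rw [hmdef]; exact_mod_cast h
  have hlog : 0 < Real.log m := Real.log_pos (by linarith)
  have hpos : 0 < 2 - m⁻¹ := by
    have : m⁻¹ ≤ 1 := inv_le_one_of_one_le₀ (by linarith)
    linarith
  have hsumQ : ∑ j, Q.real (T ⁻¹' {j}) = 1 := by
    have h := sum_measureReal_preimage_singleton (μ := Q) (Finset.univ : Finset J)
      (f := T) (fun j _ => hT (measurableSet_singleton j))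
    simpa using h
  -- The events partition the space, so their `Q`-masses sum to one. With `exp b = 2 - m⁻¹` the
  -- summed right side is `(2m - 1) / (2 - m⁻¹) - m = 0`.
  have h := Finset.sum_le_sum fun j (_ : j ∈ Finset.univ) =>
    log_mul_measureReal_le (hl j) (hli j) (hQ j) (hT (measurableSet_singleton j)) hm0
      (Real.log (2 - m⁻¹))
  have h2 := Finset.sum_le_sum fun j (_ : j ∈ Finset.univ) => hkl j
  simp only [Finset.sum_sub_distrib, ← Finset.mul_sum, Finset.sum_add_distrib, hsumQ,
    Finset.sum_const, Finset.card_univ, nsmul_eq_mul, Real.exp_neg, Real.exp_log hpos] at h h2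
  rw [← hmdef] at h h2
  have h3 : (2 - m⁻¹)⁻¹ * (m * 1 + (m - 1) * 1) = m := by
    rw [inv_mul_eq_iff_eq_mul₀ hpos.ne']
    field_simp
    ring
  rw [h3] at h
  have h4 := mul_le_mul_of_nonneg_left (log_two_sub_inv_le hm23) hm0.le
  nlinarith

/-! ### Membership of spiked Gaussians in the model class -/

theorem sum_sq_eq_one {θ : EuclideanSpace ℝ (Fin p)} (hθ : ‖θ‖ = 1) : ∑ k, θ k * θ k = 1 := by
  have h := EuclideanSpace.real_norm_sq_eq θ
  rw [hθ] at h
  simpa [sq] using h.symm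

theorem toEuclideanCLM_one_sub_outer (θ : EuclideanSpace ℝ (Fin p)) :
    Matrix.toEuclideanCLM (𝕜 := ℝ) (1 - outer θ) = spikeMap 1 0 θ := by
  ext x i
  rw [map_sub, map_one, sub_apply, spikeMap_apply, PiLp.sub_apply,
    Matrix.ofLp_toEuclideanCLM]
  simp only [Matrix.mulVec, dotProduct, outer, Matrix.of_apply, PiLp.inner_apply, PiLp.add_apply,
    PiLp.smul_apply, smul_eq_mul, one_mul, RCLike.inner_apply, conj_trivial, one_apply_eq_self,
    sub_eq_add_neg, zero_add, neg_mul, Finset.sum_mul]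
  congr 2
  exact Finset.sum_congr rfl fun j _ => by ring

/-- The operator is the projection onto the complement of `θ`; `2 ≤ p` makes this complement
nonzero, so that the norm is attained. -/
theorem norm_spikeMap_one_zero (hp : 2 ≤ p) {θ : EuclideanSpace ℝ (Fin p)} (hθ : ‖θ‖ = 1) :
    ‖spikeMap 1 0 θ‖ = 1 := by
  have hsq : ∀ x, ‖spikeMap 1 0 θ x‖ ^ 2 = ‖x‖ ^ 2 - ⟪θ, x⟫ ^ 2 := fun x => by
    rw [norm_spikeMap_sq _ _ hθ]; ring
  refine le_antisymm (ContinuousLinearMap.opNorm_le_bound _ zero_le_one fun x => ?_) ?_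
  · rw [one_mul]
    exact le_of_sq_le_sq (by rw [hsq]; nlinarith [sq_nonneg ⟪θ, x⟫]) (norm_nonneg _)
  · obtain ⟨k, rfl⟩ : ∃ k, p = k + 1 := ⟨p - 1, by omega⟩
    have : Fact (Module.finrank ℝ (EuclideanSpace ℝ (Fin (k + 1))) = k + 1) := ⟨by simp⟩
    have hfr := Submodule.finrank_orthogonal_span_singleton (𝕜 := ℝ) (n := k) (v := θ)
      (norm_ne_zero_iff.1 (by rw [hθ]; exact one_ne_zero))
    have : Nontrivial (ℝ ∙ θ)ᗮ := Module.nontrivial_of_finrank_pos (R := ℝ) (by omega)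
    obtain ⟨⟨u, hu⟩, hu0⟩ := exists_ne (0 : (ℝ ∙ θ)ᗮ)
    have hθu : ⟪θ, u⟫ = 0 := Submodule.mem_orthogonal_singleton_iff_inner_right.1 hu
    have hun : 0 < ‖u‖ := norm_pos_iff.2 fun h => hu0 (Subtype.ext h)
    have h := (spikeMap 1 0 θ).le_opNorm u
    rw [spikeMap_apply, hθu, mul_zero, zero_smul, add_zero, one_smul] at h
    exact le_of_mul_le_mul_right (by linarith) hun

theorem posSemidef_one_sub_outer {θ : EuclideanSpace ℝ (Fin p)} (hθ : ‖θ‖ = 1) :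
    (1 - outer θ).PosSemidef := by
  have hT : (1 - outer θ).conjTranspose = 1 - outer θ := by
    rw [Matrix.conjTranspose_sub, Matrix.conjTranspose_one]
    congr 1
    ext i j
    simp [outer, mul_comm]
  have hidem : outer θ * outer θ = outer θ := by
    ext i j
    simp only [Matrix.mul_apply, outer, Matrix.of_apply]
    calc ∑ k, θ i * θ k * (θ k * θ j) = (∑ k, θ k * θ k) * (θ i * θ j) := by
          rw [Finset.sum_mul]; exact Finset.sum_congr rfl fun k _ => by ring
      _ = θ i * θ j := by rw [sum_sq_eq_one hθ, one_mul]
  have h := Matrix.posSemidef_conjTranspose_mul_self (1 - outer θ)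
  rwa [hT, sub_mul, mul_sub, mul_sub, hidem, one_mul (1 : Matrix (Fin p) (Fin p) ℝ), one_mul, mul_one, sub_self,
    sub_zero] at h

theorem covMatrix_spiked {l₁ l₂ : ℝ} (h₁ : 0 ≤ l₁) (h₂ : 0 ≤ l₂)
    {θ : EuclideanSpace ℝ (Fin p)} (hθ : ‖θ‖ = 1) :
    covMatrix (spiked l₁ l₂ θ) = l₁ • outer θ + l₂ • (1 - outer θ) := by
  ext i j
  have hc (i : Fin p) : (fun x : EuclideanSpace ℝ (Fin p) => x i) =
      fun x => ⟪EuclideanSpace.basisFun (Fin p) ℝ i, x⟫ := by ext; simp [PiLp.inner_apply]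
  simp only [covMatrix, Matrix.of_apply]
  have hb (i : Fin p) (x : EuclideanSpace ℝ (Fin p)) :
      ⟪x, EuclideanSpace.basisFun (Fin p) ℝ i⟫ = x i := by
    rw [real_inner_comm]; exact (congrFun (hc i) x).symm
  rw [hc, hc, ← covarianceBilin_apply_eq_cov (memLp_spiked l₁ l₂ θ), covarianceBilin_spiked h₁ h₂ hθ,
    hb, hb, hb, Matrix.add_apply, Matrix.smul_apply, Matrix.smul_apply, Matrix.sub_apply,
    Matrix.one_apply]
  simp only [EuclideanSpace.basisFun_apply, PiLp.single_apply, outer, Matrix.of_apply,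
    smul_eq_mul, eq_comm]
  ring

theorem isModel_spiked (hp : 2 ≤ p) {l₁ l₂ : ℝ} (h₁ : 0 ≤ l₁) (h₂ : 0 ≤ l₂)
    {θ : EuclideanSpace ℝ (Fin p)} (hθ : ‖θ‖ = 1) : IsModel l₁ l₂ θ (spiked l₁ l₂ θ) where
  isProbabilityMeasure := inferInstance
  memLp := memLp_spiked l₁ l₂ θ
  norm_eq_one := hθ
  covMatrix_eq := by
    refine ⟨1 - outer θ, posSemidef_one_sub_outer hθ, ?_, ?_, covMatrix_spiked h₁ h₂ hθ⟩
    · rw [toEuclideanCLM_one_sub_outer, spikeMap_apply, real_inner_self_eq_norm_sq, hθ]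
      simp
    · rw [toEuclideanCLM_one_sub_outer, norm_spikeMap_one_zero hp hθ]

/-! ### Likelihood ratios of samples -/

/-- The log-likelihood ratio of `n` observations between spiked Gaussians with spikes `θ`, `θ'`. -/
noncomputable def logLikelihoodRatio (l₁ l₂ : ℝ) (θ θ' : EuclideanSpace ℝ (Fin p))
    (x : Fin n → EuclideanSpace ℝ (Fin p)) : ℝ :=
  ∑ i, (l₂⁻¹ - l₁⁻¹) / 2 * (⟪θ, x i⟫ ^ 2 - ⟪θ', x i⟫ ^ 2)

theorem measurable_logLikelihoodRatio (l₁ l₂ : ℝ) (θ θ' : EuclideanSpace ℝ (Fin p)) :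
    Measurable (logLikelihoodRatio (n := n) l₁ l₂ θ θ') := by
  unfold logLikelihoodRatio; fun_prop

theorem pi_spiked_eq_withDensity {l₁ l₂ : ℝ} (h₁ : 0 < l₁) (h₂ : 0 < l₂)
    {θ θ' : EuclideanSpace ℝ (Fin p)} (hθ : ‖θ‖ = 1) (hθ' : ‖θ'‖ = 1) :
    (Measure.pi fun _ : Fin n => spiked l₁ l₂ θ') =
      (Measure.pi fun _ : Fin n => spiked l₁ l₂ θ).withDensity fun x =>
        ENNReal.ofReal (Real.exp (-logLikelihoodRatio l₁ l₂ θ θ' x)) := by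
  have h := spiked_eq_withDensity_spiked h₁ h₂ hθ hθ'
  rw [h, pi_withDensity_ofReal _ _ fun x => (Real.exp_pos _).le]
  · simp only [logLikelihoodRatio, ← Real.exp_sum, Finset.sum_neg_distrib]
  · refine ⟨by fun_prop, ?_⟩
    rw [hasFiniteIntegral_iff_ofReal (Filter.Eventually.of_forall fun x => (Real.exp_pos _).le),
      ← setLIntegral_univ, ← withDensity_apply _ MeasurableSet.univ, ← h]
    exact measure_lt_top _ _

theorem integrable_log_density (l₁ l₂ : ℝ) (θ θ' : EuclideanSpace ℝ (Fin p)) :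
    Integrable (fun x => (l₂⁻¹ - l₁⁻¹) / 2 * (⟪θ, x⟫ ^ 2 - ⟪θ', x⟫ ^ 2)) (spiked l₁ l₂ θ) :=
  ((memLp_inner_spiked l₁ l₂ θ θ).integrable_sq.sub
    (memLp_inner_spiked l₁ l₂ θ θ').integrable_sq).const_mul _

theorem integrable_logLikelihoodRatio (l₁ l₂ : ℝ) (θ θ' : EuclideanSpace ℝ (Fin p)) :
    Integrable (logLikelihoodRatio l₁ l₂ θ θ') (Measure.pi fun _ : Fin n => spiked l₁ l₂ θ) :=
  integrable_finsetSum _ fun i _ => integrable_comp_eval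
    (μ := fun _ : Fin n => spiked l₁ l₂ θ) (i := i) (integrable_log_density l₁ l₂ θ θ')

/-- The Kullback-Leibler divergence between the laws of `n` observations. -/
theorem integral_logLikelihoodRatio {l₁ l₂ : ℝ} (h₁ : 0 < l₁) (h₂ : 0 < l₂)
    {θ θ' : EuclideanSpace ℝ (Fin p)} (hθ : ‖θ‖ = 1) (hθ' : ‖θ'‖ = 1) :
    ∫ x, logLikelihoodRatio l₁ l₂ θ θ' x ∂(Measure.pi fun _ : Fin n => spiked l₁ l₂ θ) =
      n * ((l₁ - l₂) ^ 2 / (l₁ * l₂) / 2 * (1 - ⟪θ, θ'⟫ ^ 2)) := by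
  unfold logLikelihoodRatio
  rw [integral_finsetSum _ fun i _ => integrable_comp_eval
    (μ := fun _ : Fin n => spiked l₁ l₂ θ) (i := i) (integrable_log_density l₁ l₂ θ θ')]
  have h : ∀ i : Fin n, ∫ x : Fin n → EuclideanSpace ℝ (Fin p),
      (l₂⁻¹ - l₁⁻¹) / 2 * (⟪θ, x i⟫ ^ 2 - ⟪θ', x i⟫ ^ 2)
        ∂(Measure.pi fun _ : Fin n => spiked l₁ l₂ θ) =
      (l₁ - l₂) ^ 2 / (l₁ * l₂) / 2 * (1 - ⟪θ, θ'⟫ ^ 2) := fun i => by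
    rw [integral_comp_eval (μ := fun _ : Fin n => spiked l₁ l₂ θ) (i := i)
      (integrable_log_density l₁ l₂ θ θ').aestronglyMeasurable, integral_const_mul,
      integral_sub (memLp_inner_spiked l₁ l₂ θ θ).integrable_sq
        (memLp_inner_spiked l₁ l₂ θ θ').integrable_sq,
      integral_inner_sq_spiked h₁.le h₂.le hθ, integral_inner_sq_spiked h₁.le h₂.le hθ,
      real_inner_self_eq_norm_sq, hθ, hθ']
    field_simp
    ring
  simp [h]

/-! ### From estimation to testing of letters -/

/-- The rank one matrix `θ θᵀ` as a vector, so that the Frobenius norm becomes a metric. -/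
noncomputable def outerVec (θ : EuclideanSpace ℝ (Fin p)) : EuclideanSpace ℝ (Fin p × Fin p) :=
  WithLp.toLp 2 fun ij => θ ij.1 * θ ij.2

theorem measurable_outerVec : Measurable (outerVec (p := p)) := by
  unfold outerVec; fun_prop

theorem frobNorm_outer_sub (θ θ' : EuclideanSpace ℝ (Fin p)) :
    frobNorm (outer θ - outer θ') = dist (outerVec θ) (outerVec θ') := by
  rw [EuclideanSpace.dist_eq, frobNorm]
  congr 1
  rw [Fintype.sum_prod_type]
  simp [outer, outerVec, Real.dist_eq, sq_abs]

theorem frobNorm_outer_sub_sq {θ θ' : EuclideanSpace ℝ (Fin p)} (hθ : ‖θ‖ = 1) (hθ' : ‖θ'‖ = 1) :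
    frobNorm (outer θ - outer θ') ^ 2 = 2 * (1 - ⟪θ, θ'⟫ ^ 2) := by
  rw [frobNorm, Real.sq_sqrt (by positivity)]
  have e : ∀ i j, (outer θ - outer θ') i j ^ 2 = θ i * θ i * (θ j * θ j)
      - 2 * (θ i * θ' i * (θ j * θ' j)) + θ' i * θ' i * (θ' j * θ' j) := fun i j => by
    simp only [Matrix.sub_apply, outer, Matrix.of_apply]; ring
  have hin : ∑ i, θ i * θ' i = ⟪θ, θ'⟫ := by simp [PiLp.inner_apply, mul_comm]
  simp only [e, Finset.sum_add_distrib, Finset.sum_sub_distrib, ← Finset.mul_sum, ← Finset.sum_mul,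
    sum_sq_eq_one hθ, sum_sq_eq_one hθ', hin]
  ring

/-- This decodes an estimator into a word. Measurability comes from `SimpleFunc.nearestPtInd`, which
breaks ties along an enumeration. -/
theorem exists_measurable_nearest {X F I : Type*} [MeasurableSpace X] [PseudoMetricSpace F]
    [MeasurableSpace F] [OpensMeasurableSpace F] [Fintype I] [Nonempty I] [MeasurableSpace I]
    (M : I → F) {g : X → F} (hg : Measurable g) :
    ∃ T : X → I, Measurable T ∧ ∀ x i, dist (M (T x)) (g x) ≤ dist (M i) (g x) := by
  obtain ⟨N, hN⟩ : ∃ N, Fintype.card I = N + 1 := ⟨Fintype.card I - 1, by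
    have := Fintype.card_pos (α := I); omega⟩
  -- The enumeration is made constant from index `N` on, as `nearestPtInd` expects a sequence over
  -- all of `ℕ`.
  let c : ℕ → I := fun k => (Fintype.equivFin I).symm ⟨min k N, by omega⟩
  refine ⟨fun x => c (SimpleFunc.nearestPtInd (M ∘ c) N (g x)),
    (measurable_from_top (f := c)).comp ((SimpleFunc.measurable _).comp hg), fun x i => ?_⟩
  have h := SimpleFunc.edist_nearestPt_le (M ∘ c) (g x) (k := Fintype.equivFin I i) (N := N)
    (by have := (Fintype.equivFin I i).2; omega)
  have hc : c (Fintype.equivFin I i) = i := by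
    have := (Fintype.equivFin I i).2
    simp only [c]
    rw [Equiv.symm_apply_eq]
    ext
    simp
    omega
  rw [Function.comp_apply, hc, edist_dist, edist_dist, ENNReal.ofReal_le_ofReal_iff dist_nonneg] at h
  exact h

/-- If tests of a single letter of a word, the other letters being known, fail with average
probability at least a quarter, then so do tests of a letter of an unknown word. -/
theorem sum_measureReal_letter_le {X I J : Type*} [MeasurableSpace X] [Fintype I] [DecidableEq I]
    [Fintype J] [MeasurableSpace J] [MeasurableSingletonClass J] (P : (I → J) → Measure X)
    [∀ w, IsProbabilityMeasure (P w)] (l : (I → J) → (I → J) → X → ℝ)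
    (hl : ∀ w w', Measurable (l w w')) (hli : ∀ w w', Integrable (l w w') (P w))
    (hP : ∀ w w', P w' = (P w).withDensity fun x => ENNReal.ofReal (Real.exp (-l w w' x)))
    (hJ : 2 ≤ Fintype.card J) (b : I)
    (hkl : ∀ w w', (∀ b' ≠ b, w b' = w' b') →
      ∫ x, l w w' x ∂(P w) ≤ Real.log (Fintype.card J) / 12)
    {T : X → I → J} (hT : Measurable T) :
    ∑ w, (P w).real {x | T x b = w b} ≤ 3 / 4 * Fintype.card (I → J) := by
  let e := Equiv.funSplitAt b J
  have hb : ∀ j r, e.symm (j, r) b = j := fun j r => by simp [e, Equiv.funSplitAt]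
  have hne : ∀ j j' r, ∀ b' ≠ b, e.symm (j, r) b' = e.symm (j', r) b' := fun j j' r b' h => by
    simp [e, Equiv.funSplitAt, h]
  -- With the other letters `r` frozen, the common reference measure of the test is the one with the
  -- arbitrary letter `j₀` at `b`.
  obtain ⟨j₀⟩ : Nonempty J := Fintype.card_pos_iff.1 (by omega)
  rw [← e.symm.sum_comp, Fintype.sum_prod_type_right, Fintype.card_congr e, Fintype.card_prod]
  have hr : ∀ r, ∑ j, (P (e.symm (j, r))).real {x | T x b = e.symm (j, r) b} ≤
      3 / 4 * Fintype.card J := fun r => by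
    have h := sum_measureReal_test_le (fun j => P (e.symm (j, r))) (P (e.symm (j₀, r)))
      (fun j => l (e.symm (j, r)) (e.symm (j₀, r))) (fun j => hl _ _) (fun j => hli _ _)
      (fun j => hP _ _) hJ (fun j => hkl _ _ (hne _ _ _)) ((measurable_pi_apply b).comp hT)
    simp only [hb]
    exact h
  refine (Finset.sum_le_sum fun r _ => hr r).trans (le_of_eq ?_)
  rw [Finset.sum_const, Finset.card_univ, nsmul_eq_mul]
  push_cast
  ring

/-- Lower bound for the risk over a family of spiked Gaussians indexed by words, whose spikes are
separated by the Hamming distance and indistinguishable in each letter. -/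
theorem exists_le_risk {I J : Type*} [Fintype I] [Nonempty I] [DecidableEq I]
    [Fintype J] [DecidableEq J] (hJ : 2 ≤ Fintype.card J) {l₁ l₂ : ℝ} (h₁ : 0 < l₁) (h₂ : 0 < l₂)
    (θ : (I → J) → EuclideanSpace ℝ (Fin p)) (hθ : ∀ w, ‖θ w‖ = 1) {ε : ℝ} (hε : 0 ≤ ε)
    (hsep : ∀ w w', ε * (hammingDist w w' / Fintype.card I) ≤ frobNorm (outer (θ w) - outer (θ w')))
    (hkl : ∀ w w', hammingDist w w' ≤ 1 → n * ((l₁ - l₂) ^ 2 / (l₁ * l₂) / 2 *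
      (1 - ⟪θ w, θ w'⟫ ^ 2)) ≤ Real.log (Fintype.card J) / 12)
    {est : (Fin n → EuclideanSpace ℝ (Fin p)) → EuclideanSpace ℝ (Fin p)} (hest : Measurable est) :
    ∃ w, ENNReal.ofReal (ε / 8) ≤ risk est (spiked l₁ l₂ (θ w)) (θ w) := by
  let : MeasurableSpace J := ⊤
  have hJ' : Nonempty J := Fintype.card_pos_iff.1 (by omega)
  set s : ℝ := (Fintype.card I : ℝ) with hs
  have hs0 : 0 < s := by rw [hs]; exact_mod_cast Fintype.card_pos
  obtain ⟨T, hT, hnear⟩ := exists_measurable_nearest (fun w => outerVec (θ w))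
    (measurable_outerVec.comp hest)
  set P : (I → J) → Measure (Fin n → EuclideanSpace ℝ (Fin p)) :=
    fun w => Measure.pi fun _ => spiked l₁ l₂ (θ w)
  have hTb : ∀ (w : I → J) (b : I), MeasurableSet {x | T x b = w b} := fun w b =>
    (measurable_pi_apply b).comp hT (measurableSet_singleton (w b))
  have hlet : ∀ b, ∑ w, (P w).real {x | T x b = w b} ≤ 3 / 4 * Fintype.card (I → J) := fun b =>
    sum_measureReal_letter_le P (fun w w' => logLikelihoodRatio l₁ l₂ (θ w) (θ w'))
      (fun _ _ => measurable_logLikelihoodRatio _ _ _ _)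
      (fun _ _ => integrable_logLikelihoodRatio _ _ _ _)
      (fun w w' => pi_spiked_eq_withDensity h₁ h₂ (hθ w) (hθ w')) hJ b
      (fun w w' h => by
        rw [integral_logLikelihoodRatio h₁ h₂ (hθ w) (hθ w')]
        refine hkl w w' ?_
        rw [hammingDist, ← Finset.card_singleton b]
        refine Finset.card_le_card fun b' hb' => ?_
        by_contra hne
        exact (Finset.mem_filter.1 hb').2 (h b' (by simpa using hne))) hT
  -- The expected number of wrong letters is at least `s / 4` on average over the words, hence for
  -- some word.
  obtain ⟨w, -, hw⟩ : ∃ w ∈ (Finset.univ : Finset (I → J)),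
      s / 4 ≤ ∑ b, (1 - (P w).real {x | T x b = w b}) := by
    refine Finset.exists_le_of_sum_le Finset.univ_nonempty ?_
    have h := Finset.sum_le_sum fun b (_ : b ∈ Finset.univ) => hlet b
    rw [Finset.sum_comm] at h
    simp only [Finset.sum_sub_distrib, Finset.sum_const, Finset.card_univ, nsmul_eq_mul, ← hs] at h ⊢
    linarith
  refine ⟨w, ?_⟩
  -- The decoded spike is at least as close to the estimate as the true one, so by the triangle
  -- inequality the loss is at least half the distance between decoded and true spike.
  have hpt : ∀ x, ε / (2 * s) * ∑ b, (1 - {x | T x b = w b}.indicator (fun _ => (1 : ℝ)) x) ≤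
      frobNorm (outer (est x) - outer (θ w)) := fun x => by
    have hham : ∑ b, (1 - {x | T x b = w b}.indicator (fun _ => (1 : ℝ)) x) =
        hammingDist (T x) w := by
      rw [hammingDist, Finset.card_filter, Nat.cast_sum]
      refine Finset.sum_congr rfl fun b _ => ?_
      by_cases h : T x b = w b <;> simp [h]
    have h1 := hsep (T x) w
    have h2 := hnear x w
    have h3 := dist_triangle_right (outerVec (θ (T x))) (outerVec (θ w)) (outerVec (est x))
    rw [frobNorm_outer_sub] at h1 ⊢
    rw [hham, dist_comm]
    simp only [Function.comp_apply] at h2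
    have h4 : ε / (2 * s) * hammingDist (T x) w = ε * (hammingDist (T x) w / s) / 2 := by
      field_simp
    rw [h4]
    linarith
  have hint : ∀ b, Integrable (fun x => 1 - {x | T x b = w b}.indicator (fun _ => (1 : ℝ)) x) (P w) :=
    fun b => (integrable_const _).sub ((integrable_const _).indicator (hTb w b))
  have hval : ∫ x, ε / (2 * s) * ∑ b, (1 - {x | T x b = w b}.indicator (fun _ => (1 : ℝ)) x) ∂(P w) =
      ε / (2 * s) * ∑ b, (1 - (P w).real {x | T x b = w b}) := by
    rw [integral_const_mul, integral_finsetSum _ fun b _ => hint b]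
    congr 1
    refine Finset.sum_congr rfl fun b _ => ?_
    rw [integral_sub (integrable_const _) ((integrable_const _).indicator (hTb w b)),
      integral_indicator_const _ (hTb w b)]
    simp
  calc ENNReal.ofReal (ε / 8)
      ≤ ENNReal.ofReal (∫ x, ε / (2 * s) *
          ∑ b, (1 - {x | T x b = w b}.indicator (fun _ => (1 : ℝ)) x) ∂(P w)) := by
        refine ENNReal.ofReal_le_ofReal ?_
        rw [hval]
        calc ε / 8 = ε / (2 * s) * (s / 4) := by field_simp; ring
          _ ≤ _ := mul_le_mul_of_nonneg_left hw (by positivity)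
    _ = ∫⁻ x, ENNReal.ofReal (ε / (2 * s) *
          ∑ b, (1 - {x | T x b = w b}.indicator (fun _ => (1 : ℝ)) x)) ∂(P w) := by
        refine ofReal_integral_eq_lintegral_ofReal
          ((integrable_finsetSum _ fun b _ => hint b).const_mul _)
          (Filter.Eventually.of_forall fun x => ?_)
        refine mul_nonneg (by positivity) (Finset.sum_nonneg fun b _ => ?_)
        by_cases h : x ∈ {x | T x b = w b} <;> simp [h]
    _ ≤ risk est (spiked l₁ l₂ (θ w)) (θ w) :=
        lintegral_mono fun x => ENNReal.ofReal_le_ofReal (hpt x)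

/-! ### Spikes indexed by words -/

section Words

variable {s m : ℕ} (φ : Option (Fin s × Fin m) ↪ Fin p) (ε : ℝ)

/-- The entries of the spike of a word: one large entry and, in each block, a small entry at the
position given by the letter. -/
noncomputable def wordEntry (w : Fin s → Fin m) : Option (Fin s × Fin m) → ℝ
  | none => √(1 - ε ^ 2)
  | some (b, j) => if w b = j then ε / √s else 0

/-- The spike of a word. -/
noncomputable def wordSpike (w : Fin s → Fin m) : EuclideanSpace ℝ (Fin p) :=
  WithLp.toLp 2 (Function.extend φ (wordEntry ε w) 0)

theorem wordSpike_apply (w : Fin s → Fin m) (a : Option (Fin s × Fin m)) :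
    wordSpike φ ε w (φ a) = wordEntry ε w a := φ.injective.extend_apply _ _ _

theorem wordSpike_apply_of_notMem (w : Fin s → Fin m) {i : Fin p} (hi : ¬∃ a, φ a = i) :
    wordSpike φ ε w i = 0 := Function.extend_apply' _ _ _ hi

theorem sum_eq_sum_embedding {A B : Type*} [Fintype A] [Fintype B] (φ : A ↪ B) (f : B → ℝ)
    (hf : ∀ b, (¬∃ a, φ a = b) → f b = 0) : ∑ b, f b = ∑ a, f (φ a) := by
  rw [← Finset.sum_map Finset.univ φ f]
  refine (Finset.sum_subset (Finset.subset_univ _) fun b _ hb => hf b ?_).symm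
  simpa using hb

theorem inner_wordSpike (hε : ε ^ 2 ≤ 1) (hs : 0 < s) (w w' : Fin s → Fin m) :
    ⟪wordSpike φ ε w, wordSpike φ ε w'⟫ = 1 - ε ^ 2 * (hammingDist w w' / s) := by
  have hs' : (0 : ℝ) < s := by exact_mod_cast hs
  have h : ⟪wordSpike φ ε w, wordSpike φ ε w'⟫ = ∑ i, wordSpike φ ε w i * wordSpike φ ε w' i := by
    simp [PiLp.inner_apply, mul_comm]
  rw [h, sum_eq_sum_embedding φ _ fun i hi => by rw [wordSpike_apply_of_notMem φ ε w hi, zero_mul]]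
  simp only [wordSpike_apply, Fintype.sum_option, Fintype.sum_prod_type, wordEntry]
  have hblock : ∀ b, ∑ j, ((if w b = j then ε / √s else 0) * if w' b = j then ε / √s else 0) =
      ε ^ 2 / s * (1 - if w b ≠ w' b then 1 else 0) := fun b => by
    rw [Finset.sum_eq_single (w b)]
    · by_cases h : w b = w' b
      · simp only [h, if_true, ne_eq, not_true, if_false]
        rw [div_mul_div_comm, Real.mul_self_sqrt hs'.le]; ring
      · simp [h, Ne.symm h]
    · intro j _ hj
      simp [Ne.symm hj]
    · simp
  simp only [hblock]
  rw [← Finset.mul_sum, Finset.sum_sub_distrib, Real.mul_self_sqrt (by linarith), hammingDist,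
    Finset.card_filter]
  push_cast
  simp only [Finset.sum_const, Finset.card_univ, Fintype.card_fin, nsmul_eq_mul, mul_one]
  field_simp
  ring

theorem norm_wordSpike (hε : ε ^ 2 ≤ 1) (hs : 0 < s) (w : Fin s → Fin m) :
    ‖wordSpike φ ε w‖ = 1 := by
  have h := inner_wordSpike φ ε hε hs w w
  rw [hammingDist_self, real_inner_self_eq_norm_sq] at h
  rw [← sq_eq_sq₀ (norm_nonneg _) zero_le_one, h]
  simp

theorem hammingDist_div_le_one (hs : 0 < s) (w w' : Fin s → Fin m) :
    (hammingDist w w' / s : ℝ) ≤ 1 := by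
  have h := hammingDist_le_card_fintype (x := w) (y := w')
  rw [Fintype.card_fin] at h
  rw [div_le_one (by exact_mod_cast hs)]
  exact_mod_cast h

/-- With `h` the normalised Hamming distance, the squared norm is `2 (1 - (1 - ε² h)²) ≥ 2 ε² h ≥ ε²
h²`. Linearity in `h` is weaker than `√h`, but lets the loss be summed over letters. -/
theorem le_frobNorm_wordSpike (hε : ε ^ 2 ≤ 1) (hs : 0 < s) (w w' : Fin s → Fin m) :
    ε * (hammingDist w w' / s) ≤
      frobNorm (outer (wordSpike φ ε w) - outer (wordSpike φ ε w')) := by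
  have hN := norm_wordSpike φ ε hε hs
  refine le_of_sq_le_sq ?_ (Real.sqrt_nonneg _)
  rw [frobNorm_outer_sub_sq (hN w) (hN w'), inner_wordSpike φ ε hε hs]
  have h1 := hammingDist_div_le_one hs w w'
  have h0 : (0 : ℝ) ≤ hammingDist w w' / s := by positivity
  set h : ℝ := hammingDist w w' / s
  have h2 : ε ^ 2 * h ≤ 1 := by nlinarith
  have h3 : 0 ≤ ε ^ 2 * h := by positivity
  have h4 : h ^ 2 ≤ h := by nlinarith
  nlinarith [mul_le_mul_of_nonneg_left h4 (sq_nonneg ε)]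

theorem one_sub_inner_wordSpike_sq_le (hε : ε ^ 2 ≤ 1) (hs : 0 < s) {w w' : Fin s → Fin m}
    (h : hammingDist w w' ≤ 1) :
    1 - ⟪wordSpike φ ε w, wordSpike φ ε w'⟫ ^ 2 ≤ 2 * (ε ^ 2 / s) := by
  rw [inner_wordSpike φ ε hε hs]
  have hs' : (0 : ℝ) < s := by exact_mod_cast hs
  have h1 : (hammingDist w w' / s : ℝ) ≤ 1 / s := by
    gcongr; exact_mod_cast h
  have h2 := mul_le_mul_of_nonneg_left h1 (sq_nonneg ε)
  have h3 : ε ^ 2 / s = ε ^ 2 * (1 / s) := by ring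
  nlinarith [sq_nonneg (ε ^ 2 * (hammingDist w w' / s : ℝ))]

theorem wordSpike_mem_lqBall_zero {R : ℝ} (hR : s ≤ R) (w : Fin s → Fin m) :
    wordSpike φ ε w ∈ lqBall 0 p (R + 1) := by
  rw [lqBall, Set.mem_ofPred_eq, if_pos rfl]
  -- The support has at most one position per block plus the large entry; the latter uses up the `+
  -- 1` in the radius.
  have hsub : {i | wordSpike φ ε w i ≠ 0} ⊆
      (fun o : Option (Fin s) => φ (o.map fun b => (b, w b))) '' Set.univ := by
    intro i hi
    by_cases h : ∃ a, φ a = i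
    · obtain ⟨a, rfl⟩ := h
      rw [Set.mem_ofPred_eq, wordSpike_apply] at hi
      match a with
      | none => exact ⟨none, trivial, rfl⟩
      | some (b, j) =>
        refine ⟨some b, trivial, ?_⟩
        simp only [wordEntry] at hi
        have : w b = j := by by_contra hne; simp [hne] at hi
        simp [this]
    · exact absurd (wordSpike_apply_of_notMem φ ε w h) hi
  have h := (Set.ncard_le_ncard hsub).trans (Set.ncard_image_le Set.finite_univ)
  rw [Set.ncard_univ, Nat.card_eq_fintype_card, Fintype.card_option, Fintype.card_fin] at h
  have : (({i | wordSpike φ ε w i ≠ 0}.ncard : ℕ) : ℝ) ≤ (s + 1 : ℕ) := by exact_mod_cast h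
  push_cast at this
  linarith

theorem wordSpike_mem_lqBall {q R : ℝ} (hq : 0 < q) (hε0 : 0 ≤ ε) (hs : 0 < s)
    (hR : ε ^ q * (s : ℝ) ^ (1 - q / 2) ≤ R) (w : Fin s → Fin m) :
    wordSpike φ ε w ∈ lqBall q p (R + 1) := by
  have hs' : (0 : ℝ) < s := by exact_mod_cast hs
  rw [lqBall, Set.mem_ofPred_eq, if_neg hq.ne', sum_eq_sum_embedding φ _ fun i hi => by
    rw [wordSpike_apply_of_notMem φ ε w hi, abs_zero, Real.zero_rpow hq.ne']]
  simp only [wordSpike_apply, Fintype.sum_option, Fintype.sum_prod_type, wordEntry]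
  have hblock : ∀ b, ∑ j, |if w b = j then ε / √s else 0| ^ q = (ε / √s) ^ q := fun b => by
    rw [Finset.sum_eq_single (w b)]
    · simp only [if_true]
      rw [abs_of_nonneg (by positivity)]
    · intro j _ hj
      simp [Ne.symm hj, Real.zero_rpow hq.ne']
    · simp
  -- The large entry is paid for by the `+ 1` in the radius.
  have hfirst : |√(1 - ε ^ 2)| ^ q ≤ 1 := by
    refine Real.rpow_le_one (abs_nonneg _) ?_ hq.le
    rw [abs_of_nonneg (Real.sqrt_nonneg _)]
    exact Real.sqrt_le_one.2 (by nlinarith [sq_nonneg ε])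
  have hrest : (s : ℝ) * (ε / √s) ^ q = ε ^ q * (s : ℝ) ^ (1 - q / 2) := by
    rw [Real.div_rpow hε0 (Real.sqrt_nonneg _), Real.sqrt_eq_rpow, ← Real.rpow_mul hs'.le,
      Real.rpow_sub hs', Real.rpow_one]
    ring_nf
  simp only [hblock, Finset.sum_const, Finset.card_univ, Fintype.card_fin, nsmul_eq_mul]
  rw [hrest]
  linarith

end Words

/-! ### Choice of the sparsity and of the perturbation size -/

/-- Lower bound for the worst-case risk in terms of the number `s` of blocks, the number `m` of
positions per block and the size `ε` of the perturbation. -/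
theorem le_worstCaseRisk_gaussianModelClass {q l₁ l₂ R ε : ℝ} {s m : ℕ} (hs : 0 < s) (hm : 2 ≤ m)
    (hsm : s * m + 1 ≤ p) (hq : 0 ≤ q) (h₂ : 0 < l₂) (h₁ : l₂ < l₁) (hε0 : 0 ≤ ε) (hε : ε ≤ 1)
    (hball : ε ^ q * (s : ℝ) ^ (1 - q / 2) ≤ R)
    (hkl : n * (ε ^ 2 / s) ≤ sigmaSq l₁ l₂ * (Real.log m / 12))
    {est : (Fin n → EuclideanSpace ℝ (Fin p)) → EuclideanSpace ℝ (Fin p)} (hest : Measurable est) :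
    ENNReal.ofReal (ε / 8) ≤ worstCaseRisk (gaussianModelClass q p l₁ l₂ R) est := by
  have hε2 : ε ^ 2 ≤ 1 := pow_le_one₀ hε0 hε
  have h₁0 : 0 < l₁ := h₂.trans h₁
  have : Nonempty (Fin s) := ⟨⟨0, hs⟩⟩
  obtain ⟨φ⟩ : Nonempty (Option (Fin s × Fin m) ↪ Fin p) :=
    Function.Embedding.nonempty_of_card_le (by simpa using hsm)
  have hN := norm_wordSpike φ ε hε2 hs
  obtain ⟨w, hw⟩ := exists_le_risk (n := n) (by simpa using hm) h₁0 h₂ (wordSpike φ ε) hN hε0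
    (fun w w' => by simpa using le_frobNorm_wordSpike φ ε hε2 hs w w')
    (fun w w' h => by
      have h1 := one_sub_inner_wordSpike_sq_le φ ε hε2 hs h
      have hd : l₁ - l₂ ≠ 0 := (sub_pos.2 h₁).ne'
      have hσ : (l₁ - l₂) ^ 2 / (l₁ * l₂) * sigmaSq l₁ l₂ = 1 := by
        rw [sigmaSq]; field_simp
      have hpos : 0 ≤ (l₁ - l₂) ^ 2 / (l₁ * l₂) := by positivity
      rw [Fintype.card_fin]
      calc n * ((l₁ - l₂) ^ 2 / (l₁ * l₂) / 2 * (1 - ⟪wordSpike φ ε w, wordSpike φ ε w'⟫ ^ 2))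
          ≤ n * ((l₁ - l₂) ^ 2 / (l₁ * l₂) / 2 * (2 * (ε ^ 2 / s))) := by gcongr
        _ = (l₁ - l₂) ^ 2 / (l₁ * l₂) * (n * (ε ^ 2 / s)) := by ring
        _ ≤ (l₁ - l₂) ^ 2 / (l₁ * l₂) * (sigmaSq l₁ l₂ * (Real.log m / 12)) :=
            mul_le_mul_of_nonneg_left hkl hpos
        _ = Real.log m / 12 := by rw [← mul_assoc, hσ, one_mul]) hest
  refine hw.trans ?_
  have hmem : (spiked l₁ l₂ (wordSpike φ ε w), wordSpike φ ε w) ∈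
      gaussianModelClass q p l₁ l₂ R := by
    refine ⟨⟨isModel_spiked (by nlinarith) h₁0.le h₂.le (hN w), ?_⟩, inferInstance⟩
    rcases hq.eq_or_lt with rfl | hq
    · exact wordSpike_mem_lqBall_zero φ ε (by simpa using hball) w
    · exact wordSpike_mem_lqBall φ ε hq hε0 hs hball w
  exact le_iSup₂ (f := fun (Pθ : Measure (EuclideanSpace ℝ (Fin p)) × EuclideanSpace ℝ (Fin p))
    (_ : Pθ ∈ gaussianModelClass q p l₁ l₂ R) => risk est Pθ.1 Pθ.2) _ hmem

/-- Take `s = ⌊S⌋` and `m = ⌊x⌋` with `x = (p - 1) / s ≥ 2`. Rounding costs only factors of two,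
because `x < m + 1 ≤ m²` for `m ≥ 2`. -/
theorem exists_block_sizes {S : ℝ} (hS : 1 ≤ S) (hp : Real.exp 1 * S ≤ (p : ℝ) - 1) :
    ∃ s m : ℕ, 0 < s ∧ (s : ℝ) ≤ S ∧ S ≤ 2 * s ∧ 2 ≤ m ∧ s * m + 1 ≤ p ∧
      Real.log (((p : ℝ) - 1) / S) ≤ 2 * Real.log m := by
  have he : (2 : ℝ) ≤ Real.exp 1 := by have := Real.add_one_le_exp (1 : ℝ); linarith
  have hs : 0 < ⌊S⌋₊ := Nat.floor_pos.2 hS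
  have hs1 : (1 : ℝ) ≤ ⌊S⌋₊ := by exact_mod_cast hs
  have hsS : (⌊S⌋₊ : ℝ) ≤ S := Nat.floor_le (by linarith)
  have hS2 : S ≤ 2 * ⌊S⌋₊ := by linarith [Nat.lt_floor_add_one S]
  have hd : 0 < (p : ℝ) - 1 := by nlinarith
  set x : ℝ := ((p : ℝ) - 1) / ⌊S⌋₊ with hx
  have hx2 : 2 ≤ x := by
    rw [hx, le_div_iff₀ (by linarith)]
    nlinarith
  have hm2 : 2 ≤ ⌊x⌋₊ := Nat.le_floor (by exact_mod_cast hx2)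
  have hm2' : (2 : ℝ) ≤ ⌊x⌋₊ := by exact_mod_cast hm2
  refine ⟨⌊S⌋₊, ⌊x⌋₊, hs, hsS, hS2, hm2, ?_, ?_⟩
  · have h := mul_le_mul_of_nonneg_left (Nat.floor_le (by linarith : (0 : ℝ) ≤ x))
      (by linarith : (0 : ℝ) ≤ ⌊S⌋₊)
    rw [hx, mul_div_cancel₀ _ (by linarith), ← hx] at h
    have h' : ((⌊S⌋₊ * ⌊x⌋₊ + 1 : ℕ) : ℝ) ≤ p := by push_cast; linarith
    exact_mod_cast h'
  · have h1 : ((p : ℝ) - 1) / S ≤ (⌊x⌋₊ : ℝ) ^ 2 := by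
      have h2 : ((p : ℝ) - 1) / S ≤ x := by rw [hx]; gcongr
      nlinarith [Nat.lt_floor_add_one x]
    have h2 := Real.log_le_log (by positivity) h1
    rwa [Real.log_pow, Nat.cast_ofNat] at h2

/-- Lower bound for the worst-case risk in terms of a real sparsity level `S`. -/
theorem le_worstCaseRisk_of_sparsity {q l₁ l₂ R ε S : ℝ} (hn : 1 ≤ n) (hq : 0 ≤ q) (hq1 : q ≤ 1)
    (h₂ : 0 < l₂) (h₁ : l₂ < l₁) (hS : 1 ≤ S) (hp : Real.exp 1 * S ≤ (p : ℝ) - 1)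
    (hε0 : 0 ≤ ε) (hε : ε ≤ 1) (hball : ε ^ q * S ^ (1 - q / 2) ≤ R)
    (hεS : ε ^ 2 ≤ S * (sigmaSq l₁ l₂ / n * Real.log (((p : ℝ) - 1) / S)) / 48)
    {est : (Fin n → EuclideanSpace ℝ (Fin p)) → EuclideanSpace ℝ (Fin p)} (hest : Measurable est) :
    ENNReal.ofReal (ε / 8) ≤ worstCaseRisk (gaussianModelClass q p l₁ l₂ R) est := by
  obtain ⟨s, m, hs, hsS, hS2, hm, hsm, hlog⟩ := exists_block_sizes hS hp
  have hs' : (0 : ℝ) < s := by exact_mod_cast hs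
  have hn' : (0 : ℝ) < n := by exact_mod_cast hn
  have hσ : 0 ≤ sigmaSq l₁ l₂ := by
    rw [sigmaSq]; have := h₂.trans h₁; positivity
  have hm0 : 0 ≤ Real.log m := Real.log_natCast_nonneg m
  refine le_worstCaseRisk_gaussianModelClass hs hm hsm hq h₂ h₁ hε0 hε ?_ ?_ hest
  · refine le_trans ?_ hball
    have := Real.rpow_le_rpow hs'.le hsS (by linarith : 0 ≤ 1 - q / 2)
    gcongr
  -- The constant is `48 = 12 · 2 · 2`: one factor two from `S ≤ 2 s`, one from the logarithm.
  · calc n * (ε ^ 2 / s)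
        ≤ n * ((S * (sigmaSq l₁ l₂ / n * Real.log (((p : ℝ) - 1) / S)) / 48) / s) := by gcongr
      _ ≤ n * ((S * (sigmaSq l₁ l₂ / n * (2 * Real.log m)) / 48) / s) := by gcongr
      _ ≤ n * (((2 * s) * (sigmaSq l₁ l₂ / n * (2 * Real.log m)) / 48) / s) := by gcongr
      _ = sigmaSq l₁ l₂ * (Real.log m / 12) := by field_simp; ring

/-- Lower bound for the worst-case risk with the sparsity level `R ^ (2 / (2 - q))`. -/
theorem le_worstCaseRisk_of_radius {q l₁ l₂ R t : ℝ} (hn : 1 ≤ n) (hq : 0 ≤ q) (hq1 : q ≤ 1)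
    (h₂ : 0 < l₂) (h₁ : l₂ < l₁) (hR : 1 ≤ R)
    (hp : Real.exp 1 * R ^ (2 / (2 - q)) ≤ (p : ℝ) - 1) (ht0 : 0 ≤ t)
    (ht : t = sigmaSq l₁ l₂ / n * Real.log (((p : ℝ) - 1) / R ^ (2 / (2 - q))))
    {est : (Fin n → EuclideanSpace ℝ (Fin p)) → EuclideanSpace ℝ (Fin p)} (hest : Measurable est) :
    ENNReal.ofReal (min 1 √(R ^ (2 / (2 - q)) * t / 48) / 8) ≤
      worstCaseRisk (gaussianModelClass q p l₁ l₂ R) est := by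
  have hS : 1 ≤ R ^ (2 / (2 - q)) := Real.one_le_rpow hR (div_nonneg zero_le_two (by linarith))
  have hε0 : 0 ≤ min 1 √(R ^ (2 / (2 - q)) * t / 48) := le_min zero_le_one (Real.sqrt_nonneg _)
  refine le_worstCaseRisk_of_sparsity hn hq hq1 h₂ h₁ hS hp hε0 (min_le_left _ _) ?_ ?_ hest
  -- At this sparsity `S ^ (1 - q/2) = R`, so the ball condition holds for every `ε ≤ 1`.
  · rw [← Real.rpow_mul (by linarith), show 2 / (2 - q) * (1 - q / 2) = 1 by
      have : 2 - q ≠ 0 := by linarith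
      field_simp, Real.rpow_one]
    exact mul_le_of_le_one_left (by linarith) (Real.rpow_le_one hε0 (min_le_left _ _) hq)
  · rw [← ht]
    exact (pow_le_pow_left₀ hε0 (min_le_right _ _) 2).trans_eq (Real.sq_sqrt (by positivity))

/-- Lower bound for the worst-case risk with a sparsity level proportional to `R t ^ (-q / 2)`. -/
theorem le_worstCaseRisk_of_effective_sparsity {q α κ a l₁ l₂ R t L : ℝ} (hn : 1 ≤ n) (hq : 0 < q)
    (hq1 : q ≤ 1) (hα : 0 < α) (hα1 : α ≤ 1) (ha0 : 0 < a) (ha1 : a ≤ 1)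
    (ha : a * κ ^ q ≤ (Real.exp 1)⁻¹) (h₂ : 0 < l₂) (h₁ : l₂ < l₁) (hR : 1 ≤ R)
    (hd : 0 < (p : ℝ) - 1) (hL : L = Real.log (((p : ℝ) - 1) / R ^ (2 / (2 - q)))) (hL0 : 0 < L)
    (ht : t = sigmaSq l₁ l₂ / n * L) (ht0 : 0 < t)
    (hup : R ≤ κ ^ q * ((p : ℝ) - 1) ^ (1 - α) * R ^ (2 * α / (2 - q)) * t ^ (q / 2))
    (hS : 1 ≤ a * (R * t ^ (-(q / 2)))) (hy : R * t ^ (1 - q / 2) ≤ 1)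
    {est : (Fin n → EuclideanSpace ℝ (Fin p)) → EuclideanSpace ℝ (Fin p)} (hest : Measurable est) :
    ENNReal.ofReal (√(a * α / 48 * (R * t ^ (1 - q / 2))) / 8) ≤
      worstCaseRisk (gaussianModelClass q p l₁ l₂ R) est := by
  have hR0 : 0 < R := by linarith
  set d : ℝ := (p : ℝ) - 1
  set S : ℝ := a * (R * t ^ (-(q / 2))) with hSdef
  have hS0 : 0 < S := by linarith
  have hb0 : 0 ≤ a * α / 48 := by positivity
  have hb1 : a * α / 48 ≤ 1 := by nlinarith
  have hy0 : 0 < R * t ^ (1 - q / 2) := by positivity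
  -- Since `R ^ (2/(2-q)) = d exp (-L)`, the upper condition on the radius reads `R t ^ (-q/2) ≤ κ ^
  -- q d exp (-α L)`.
  have hexp : d * Real.exp (-(α * L)) = d ^ (1 - α) * R ^ (2 * α / (2 - q)) := by
    have h1 : Real.exp (-(α * L)) = (R ^ (2 / (2 - q)) / d) ^ α := by
      rw [Real.rpow_def_of_pos (by positivity), ← inv_div, Real.log_inv, ← hL]
      ring_nf
    rw [h1, Real.div_rpow (by positivity) hd.le, ← Real.rpow_mul hR0.le, Real.rpow_sub hd,
      Real.rpow_one, show 2 / (2 - q) * α = 2 * α / (2 - q) by ring]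
    ring
  have hSd : S ≤ (Real.exp 1)⁻¹ * (d * Real.exp (-(α * L))) := by
    have h1 : R * t ^ (-(q / 2)) ≤ κ ^ q * (d * Real.exp (-(α * L))) := by
      rw [Real.rpow_neg ht0.le, ← div_eq_mul_inv, div_le_iff₀ (by positivity), hexp]
      linarith
    calc S ≤ a * (κ ^ q * (d * Real.exp (-(α * L)))) := mul_le_mul_of_nonneg_left h1 ha0.le
      _ = a * κ ^ q * (d * Real.exp (-(α * L))) := by ring
      _ ≤ _ := mul_le_mul_of_nonneg_right ha (by positivity)
  have hSd' : Real.exp 1 * S ≤ d * Real.exp (-(α * L)) := by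
    rwa [← le_inv_mul_iff₀ (Real.exp_pos 1)]
  have hlog : α * L ≤ Real.log (d / S) := by
    rw [Real.le_log_iff_exp_le (by positivity), le_div_iff₀ hS0]
    have h1 : S ≤ d * Real.exp (-(α * L)) := by
      have := Real.add_one_le_exp (1 : ℝ)
      nlinarith
    calc Real.exp (α * L) * S ≤ Real.exp (α * L) * (d * Real.exp (-(α * L))) := by gcongr
      _ = d := by rw [mul_left_comm, ← Real.exp_add, add_neg_cancel, Real.exp_zero, mul_one]
  refine le_worstCaseRisk_of_sparsity hn hq.le hq1 h₂ h₁ hS ?_ (Real.sqrt_nonneg _)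
    (Real.sqrt_le_one.2 (mul_le_one₀ hb1 hy0.le hy)) ?_ ?_ hest
  · refine hSd'.trans (mul_le_of_le_one_right hd.le (Real.exp_le_one_iff.2 ?_))
    have : 0 ≤ α * L := by positivity
    linarith
  -- In `ε ^ q S ^ (1 - q/2)`, with constants at most one dropped, the powers of `t` cancel and
  -- those of `R` add up to one.
  · have h1 : √(a * α / 48 * (R * t ^ (1 - q / 2))) ^ q ≤ (R * t ^ (1 - q / 2)) ^ (q / 2) := by
      rw [Real.sqrt_eq_rpow, ← Real.rpow_mul (by positivity), show 1 / 2 * q = q / 2 by ring]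
      exact Real.rpow_le_rpow (by positivity) (mul_le_of_le_one_left hy0.le hb1) (by linarith)
    have h2 : S ^ (1 - q / 2) ≤ (R * t ^ (-(q / 2))) ^ (1 - q / 2) :=
      Real.rpow_le_rpow hS0.le (mul_le_of_le_one_left (by positivity) ha1) (by linarith)
    refine (mul_le_mul h1 h2 (by positivity) (by positivity)).trans (le_of_eq ?_)
    rw [Real.mul_rpow hR0.le (by positivity), Real.mul_rpow hR0.le (by positivity),
      ← Real.rpow_mul ht0.le, ← Real.rpow_mul ht0.le, mul_mul_mul_comm, ← Real.rpow_add hR0,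
      ← Real.rpow_add ht0, show q / 2 + (1 - q / 2) = 1 by ring,
      show (1 - q / 2) * (q / 2) + -(q / 2) * (1 - q / 2) = 0 by ring, Real.rpow_one,
      Real.rpow_zero, mul_one]
  · have hσ : 0 ≤ sigmaSq l₁ l₂ / n := by
      rw [sigmaSq]; have := h₂.trans h₁; positivity
    rw [Real.sq_sqrt (by positivity)]
    calc a * α / 48 * (R * t ^ (1 - q / 2)) = S * (sigmaSq l₁ l₂ / n * (α * L)) / 48 := by
          rw [mul_left_comm _ α, ← ht, hSdef, sub_eq_add_neg, Real.rpow_add ht0, Real.rpow_one]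
          ring
      _ ≤ _ := by gcongr

end SparsePCA

/-! ### Combination of the regimes -/

theorem theorem1 (q : ℝ) (hq : q ∈ Set.Icc (0 : ℝ) 1)
    (α : ℝ) (hα : α ∈ Set.Ioc (0 : ℝ) 1) (κ : ℝ) (hκ : 0 < κ) :
    ∃ c : ℝ, 0 < c ∧
      ∀ (p n : ℕ) (l₁ l₂ Rbar : ℝ), 1 ≤ n → 0 ≤ l₂ → l₂ < l₁ →
        SparsePCA.RadiusCondition q α κ p n l₁ l₂ Rbar →
        ∀ est : (Fin n → EuclideanSpace ℝ (Fin p)) → EuclideanSpace ℝ (Fin p),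
          Measurable est →
          ENNReal.ofReal (c * SparsePCA.rate q p n l₁ l₂ Rbar) ≤
              SparsePCA.worstCaseRisk (SparsePCA.modelClass q p l₁ l₂ Rbar) est ∧
            ENNReal.ofReal (c * SparsePCA.rate q p n l₁ l₂ Rbar) ≤
              SparsePCA.worstCaseRisk (SparsePCA.gaussianModelClass q p l₁ l₂ Rbar) est := by
  obtain ⟨hq0, hq1⟩ := hq
  obtain ⟨hα0, hα1⟩ := hα
  have he := Real.exp_pos 1
  -- The factor `a` shrinks the sparsity `R t ^ (-q/2)` enough to absorb `κ ^ q` and leave the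
  -- margin `e` between `S` and `p - 1`.
  set a : ℝ := min 1 ((Real.exp 1)⁻¹ * (κ ^ q)⁻¹)
  have hκq : 0 < κ ^ q := Real.rpow_pos_of_pos hκ q
  have ha0 : 0 < a := lt_min one_pos (by positivity)
  have ha1 : a ≤ 1 := min_le_left _ _
  have haκ : a * κ ^ q ≤ (Real.exp 1)⁻¹ := by
    rw [← le_mul_inv_iff₀ hκq]; exact min_le_right _ _
  -- For `q = 0` the quotient `2 / q` is `0` by convention, so this power is `1`.
  have haq0 : 0 < a ^ (2 / q) := Real.rpow_pos_of_pos ha0 _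
  have haq1 : a ^ (2 / q) ≤ 1 := Real.rpow_le_one ha0.le ha1 (by positivity)
  set c₁ : ℝ := √(a * α / 48)
  set c₂ : ℝ := √(a ^ (2 / q) / 48)
  have hc₁ : 0 < c₁ := Real.sqrt_pos.2 (by positivity)
  have hc₂ : 0 < c₂ := Real.sqrt_pos.2 (by positivity)
  have hc₂1 : c₂ ≤ 1 := Real.sqrt_le_one.2 (by linarith)
  refine ⟨min c₁ c₂ / 8, by positivity, fun p n l₁ l₂ R hn h₂ h₁ hR est hest => ?_⟩
  suffices h : ENNReal.ofReal (min c₁ c₂ / 8 * SparsePCA.rate q p n l₁ l₂ R) ≤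
      SparsePCA.worstCaseRisk (SparsePCA.gaussianModelClass q p l₁ l₂ R) est from
    ⟨h.trans (biSup_mono fun _ hx => hx.1), h⟩
  -- For `λ₂ = 0` the Gaussians degenerate, but `σ² = 0` makes the rate vanish.
  rcases h₂.eq_or_lt with rfl | h₂
  · have h0 : SparsePCA.rate q p n l₁ 0 R = 0 := by
      rw [SparsePCA.rate, SparsePCA.sigmaSq, mul_zero, zero_div, zero_div, zero_mul,
        Real.zero_rpow (by linarith), mul_zero, min_eq_right zero_le_one]
    simp [h0]
  have hR1 := hR.one_le
  have hR0 : 0 < R := by linarith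
  have hp2 : 2 ≤ p := by
    by_contra hlt
    have hdim := hR.le_dim
    -- Absolute values are needed because the base is `-1` for `p = 0`.
    have hpow : ((p : ℝ) - 1) ^ (1 - q / 2) ≤ 1 := by
      refine (le_abs_self _).trans ((Real.abs_rpow_le_abs_rpow _ _).trans ?_)
      refine Real.rpow_le_one (abs_nonneg _) ?_ (by linarith)
      have : p = 0 ∨ p = 1 := by omega
      rcases this with rfl | rfl <;> norm_num
    have h1 : (Real.exp 1)⁻¹ < 1 := inv_lt_one_of_one_lt₀ (Real.one_lt_exp_iff.2 one_pos)
    nlinarith [inv_pos.2 he]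
  have hd : 0 < (p : ℝ) - 1 := by
    have : (2 : ℝ) ≤ p := by exact_mod_cast hp2
    linarith
  have hq2 : 0 < 2 - q := by linarith
  have hexp1 : (1 - q / 2) * (2 / (2 - q)) = 1 := by field_simp
  have hp : Real.exp 1 * R ^ (2 / (2 - q)) ≤ (p : ℝ) - 1 := by
    have h := Real.rpow_le_rpow hR0.le hR.le_dim (by positivity : 0 ≤ 2 / (2 - q))
    rw [Real.mul_rpow (by positivity) (by positivity), ← Real.rpow_mul hd.le, hexp1,
      Real.rpow_one] at h
    have h1 : (Real.exp 1)⁻¹ ^ (2 / (2 - q)) ≤ (Real.exp 1)⁻¹ := by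
      refine Real.rpow_le_self_of_le_one (by positivity)
        (inv_le_one_of_one_le₀ (Real.one_le_exp zero_le_one)) ?_
      rw [le_div_iff₀ hq2]; linarith
    rw [← le_inv_mul_iff₀ he]
    exact h.trans (mul_le_mul_of_nonneg_right h1 hd.le)
  have hS1 : 1 ≤ R ^ (2 / (2 - q)) := Real.one_le_rpow hR1 (by positivity)
  obtain ⟨L, hL⟩ : ∃ L, L = Real.log (((p : ℝ) - 1) / R ^ (2 / (2 - q))) := ⟨_, rfl⟩
  obtain ⟨t, ht⟩ : ∃ t, t = SparsePCA.sigmaSq l₁ l₂ / n * L := ⟨_, rfl⟩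
  have hL0 : 0 < L := by
    rw [hL]
    refine Real.log_pos ((one_lt_div (by positivity)).2 ?_)
    have := Real.one_lt_exp_iff.2 (one_pos (α := ℝ))
    nlinarith
  have ht0 : 0 < t := by
    have h1 : 0 < l₁ - l₂ := sub_pos.2 h₁
    have h2 : 0 < l₁ := h₂.trans h₁
    have h3 : (0 : ℝ) < n := by exact_mod_cast hn
    rw [ht, SparsePCA.sigmaSq]
    positivity
  have hup := hR.upper
  rw [← hL, ← ht] at hup
  have hrate : SparsePCA.rate q p n l₁ l₂ R = min 1 √(R * t ^ (1 - q / 2)) := by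
    rw [SparsePCA.rate, ← hL, ← ht, Real.sqrt_mul hR0.le, Real.sqrt_eq_rpow, Real.sqrt_eq_rpow,
      ← Real.rpow_mul ht0.le]
    ring_nf
  rw [hrate]
  have hA := SparsePCA.le_worstCaseRisk_of_radius hn hq0 hq1 h₂ h₁ hR1 hp ht0.le
    (by rw [← hL]; exact ht) hest
  -- As soon as `R ^ (2/(2-q)) t` is bounded below by a constant, the first choice of sparsity gives
  -- a constant bound, and the rate is at most one.
  have large : ∀ y₀, y₀ ≤ R ^ (2 / (2 - q)) * t → a ^ (2 / q) ≤ y₀ →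
      ENNReal.ofReal (min c₁ c₂ / 8 * min 1 √(R * t ^ (1 - q / 2))) ≤
        SparsePCA.worstCaseRisk (SparsePCA.gaussianModelClass q p l₁ l₂ R) est := by
    intro y₀ h1 h2
    refine le_trans (ENNReal.ofReal_le_ofReal ?_) hA
    have h3 : c₂ ≤ min 1 √(R ^ (2 / (2 - q)) * t / 48) :=
      le_min hc₂1 (Real.sqrt_le_sqrt (by linarith))
    calc min c₁ c₂ / 8 * min 1 √(R * t ^ (1 - q / 2)) ≤ c₂ / 8 * 1 := by
          gcongr
          · exact min_le_right _ _
          · exact min_le_left _ _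
      _ ≤ _ := by linarith
  rcases hq0.eq_or_lt with rfl | hq0
  · refine le_trans (ENNReal.ofReal_le_ofReal ?_) hA
    have h1 : R ^ ((2 : ℝ) / (2 - 0)) * t / 48 = 1 / 48 * (R * t ^ (1 - (0 : ℝ) / 2)) := by
      norm_num; ring
    have h2 : c₂ = √(1 / 48) := by simp [c₂]
    rw [h1, Real.sqrt_mul (by norm_num : (0 : ℝ) ≤ 1 / 48), ← h2]
    calc min c₁ c₂ / 8 * min 1 √(R * t ^ (1 - (0 : ℝ) / 2))
        ≤ c₂ / 8 * min 1 √(R * t ^ (1 - (0 : ℝ) / 2)) := by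
          gcongr
          exact min_le_right _ _
      _ = c₂ * min 1 √(R * t ^ (1 - (0 : ℝ) / 2)) / 8 := by ring
      _ ≤ min 1 (c₂ * √(R * t ^ (1 - (0 : ℝ) / 2))) / 8 := by
          gcongr
          refine le_min ?_ (mul_le_mul_of_nonneg_left (min_le_right _ _) hc₂.le)
          exact mul_le_one₀ hc₂1 (by positivity) (min_le_left _ _)
  · rcases le_or_gt (R * t ^ (1 - q / 2)) 1 with hy | hy
    · rcases le_or_gt 1 (a * (R * t ^ (-(q / 2)))) with hS | hS
      · refine le_trans (ENNReal.ofReal_le_ofReal ?_)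
          (SparsePCA.le_worstCaseRisk_of_effective_sparsity hn hq0 hq1 hα0 hα1 ha0 ha1 haκ h₂ h₁
            hR1 hd hL hL0 ht ht0 hup hS hy hest)
        rw [Real.sqrt_mul (by positivity : 0 ≤ a * α / 48), div_mul_eq_mul_div]
        gcongr
        · exact min_le_left _ _
        · exact min_le_right _ _
      -- A sparsity below one means `a R < t ^ (q/2)`; as `R ≥ 1`, this forces `t ≥ a ^ (2/q)`.
      · refine large t (le_mul_of_one_le_left ht0.le hS1) ?_
        have h1 : a ≤ t ^ (q / 2) := by
          rw [Real.rpow_neg ht0.le, ← mul_assoc, ← div_eq_mul_inv,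
            div_lt_one (by positivity)] at hS
          nlinarith
        have h2 := Real.rpow_le_rpow ha0.le h1 (by positivity : 0 ≤ 2 / q)
        rwa [← Real.rpow_mul ht0.le, show q / 2 * (2 / q) = 1 by field_simp, Real.rpow_one] at h2
    -- Raising `R t ^ (1 - q/2) > 1` to the power `2/(2-q)` gives `R ^ (2/(2-q)) t ≥ 1`.
    · refine large 1 ?_ haq1
      have h := Real.one_le_rpow hy.le (by positivity : 0 ≤ 2 / (2 - q))
      rwa [Real.mul_rpow hR0.le (by positivity), ← Real.rpow_mul ht0.le, hexp1,
        Real.rpow_one] at h
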